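/- Let $A=(a_{ij})_{-1\le i,j\le 8}$ be the Cartan matrix of $E_{10}$: $a_{ii}=2$; $a_{ij}=-1$ if the nodes $i\neq j$ are joined in the Dynkin diagram, which consists of the chain $\alpha_{-1}-\alpha_0-\alpha_1-\cdots-\alpha_7$ together with one further node $\alpha_8$ joined to $\alpha_5$ only; and $a_{ij}=0$ otherwise. Let $\mathfrak h$ be a real vector space of dimension $10$ with bases $\{\alpha_i^\vee\}$ of $\mathfrak h$ and $\{\alpha_i\}$ of $\mathfrak h^*$ such that $\alpha_j(\alpha_i^\vee)=a_{ij}$, and let $(\cdot|\cdot)$ be the bilinear form on $\mathfrak h^*$ with $(\alpha_i|\alpha_j)=a_{ij}$. Let $\mathfrak g$ be the Kac–Moody algebra $E_{10}$ over $\mathbb C$, i.e. the complex Lie algebra with generators $\mathfrak h\cup\{e_i,f_i\}_{i=-1}^{8}$ (the map from $\mathfrak h$ being linear over $\mathbb R$) and the Chevalley–Serre relations of $A$: $$[h,h']=0,\quad [e_i,f_j]=\delta_{ij}\alpha_i^\vee,\quad [h,e_i]=\alpha_i(h)e_i,\quad [h,f_i]=-\alpha_i(h)f_i\qquad(h,h'\in\mathfrak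 h),$$ $$\mathrm{ad}(e_i)^{1-a_{ij}}e_j=0=\mathrm{ad}(f_i)^{1-a_{ij}}f_j\qquad(i\ne j).$$ A root is a non-zero $\alpha\in\mathfrak h^*$ for which some non-zero $x\in\mathfrak g$ satisfies $[h,x]=\alpha(h)x$ for all $h\in\mathfrak h$; it is positive if it is a combination of $\alpha_{-1},\dots,\alpha_8$ with non-negative integer coefficients, and imaginary if $(\alpha|\alpha)\le 0$. The Weyl group $W$ is the group of linear automorphisms of $\mathfrak h^*$ generated by the simple reflections $r_i(\lambda)=\lambda-\lambda(\alpha_i^\vee)\alpha_i$, $i=-1,\dots,8$. Then for every positive imaginary root $\alpha$ of $E_{10}$ with $(\alpha|\alpha)=-2$ there is $w\in W$ such that $$w(\alpha)=\alpha_{-1}+2\alpha_0+4\alpha_1+6\alpha_2+8\alpha_3+10\alpha_4+12\alpha_5+8\alpha_6+4\alpha_7+6\alpha_8 .$$ -/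

import Mathlib

noncomputable section

namespace E10

/-- The Cartan matrix of `E₁₀`. The nodes `α₋₁, α₀, …, α₈` of the Dynkin diagram are numbered
`0, 1, …, 9`, that is, index `i : Fin 10` stands for the node `α_{i-1}`. The nodes
`α₋₁ — α₀ — ⋯ — α₇` form a chain and `α₈` is attached to `α₅`. -/
def cartanMatrix : Matrix (Fin 10) (Fin 10) ℤ :=
  !![ 2, -1,  0,  0,  0,  0,  0,  0,  0,  0;
     -1,  2, -1,  0,  0,  0,  0,  0,  0,  0;
      0, -1,  2, -1,  0,  0,  0,  0,  0,  0;
      0,  0, -1,  2, -1,  0,  0,  0,  0,  0;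
      0,  0,  0, -1,  2, -1,  0,  0,  0,  0;
      0,  0,  0,  0, -1,  2, -1,  0,  0,  0;
      0,  0,  0,  0,  0, -1,  2, -1,  0, -1;
      0,  0,  0,  0,  0,  0, -1,  2, -1,  0;
      0,  0,  0,  0,  0,  0,  0, -1,  2,  0;
      0,  0,  0,  0,  0,  0, -1,  0,  0,  2]

/-- The inverse of the Cartan matrix, used only to see that the simple roots form a basis. -/
def cartanMatrixInv : Matrix (Fin 10) (Fin 10) ℤ :=
  -!![0, 1, 2, 3, 4, 5, 6, 4, 2, 3;
      1, 2, 4, 6, 8, 10, 12, 8, 4, 6;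
      2, 4, 6, 9, 12, 15, 18, 12, 6, 9;
      3, 6, 9, 12, 16, 20, 24, 16, 8, 12;
      4, 8, 12, 16, 20, 25, 30, 20, 10, 15;
      5, 10, 15, 20, 25, 30, 36, 24, 12, 18;
      6, 12, 18, 24, 30, 36, 42, 28, 14, 21;
      4, 8, 12, 16, 20, 24, 28, 18, 9, 14;
      2, 4, 6, 8, 10, 12, 14, 9, 4, 7;
      3, 6, 9, 12, 15, 18, 21, 14, 7, 10]

theorem cartanMatrix_mul_inv : cartanMatrix * cartanMatrixInv = 1 := by
  decide +kernel

/-- The real Cartan subalgebra `𝔥`, of dimension 10, in coordinates with respect to the simple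
coroots (the Cartan matrix is non-singular, so that the simple coroots span `𝔥`). -/
abbrev Cartan : Type := Fin 10 → ℝ

/-- The dual space `𝔥*`. -/
abbrev CartanDual : Type := Module.Dual ℝ Cartan

/-- The simple coroots `αᵢ^∨ ∈ 𝔥`. -/
def simpleCoroot (i : Fin 10) : Cartan := Pi.single i 1

/-- The simple roots `αⱼ ∈ 𝔥*`, given by `αⱼ(αᵢ^∨) = aᵢⱼ`. -/
def simpleRoot (j : Fin 10) : CartanDual :=
  ∑ i, (cartanMatrix i j : ℝ) • LinearMap.proj i

theorem simpleRoot_simpleCoroot (i j : Fin 10) :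
    simpleRoot j (simpleCoroot i) = cartanMatrix i j := by
  simp [simpleRoot, simpleCoroot, Pi.single_apply]

theorem linearIndependent_simpleRoot : LinearIndependent ℝ simpleRoot := by
  rw [Fintype.linearIndependent_iff]
  intro g hg
  have h1 : (cartanMatrix.map (Int.cast : ℤ → ℝ)).mulVec g = 0 := by
    funext i
    have := LinearMap.congr_fun hg (simpleCoroot i)
    simpa [simpleRoot_simpleCoroot, Matrix.mulVec, dotProduct, mul_comm] using this
  have h2 : cartanMatrix.map (Int.cast : ℤ → ℝ) * cartanMatrixInv.map (Int.cast : ℤ → ℝ) = 1 := by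
    have := congrArg (Int.castRingHom ℝ).mapMatrix cartanMatrix_mul_inv
    rwa [map_mul, map_one] at this
  have h3 := mul_eq_one_comm.mp h2
  have h4 : g = 0 := by
    rw [← Matrix.one_mulVec g, ← h3, ← Matrix.mulVec_mulVec, h1, Matrix.mulVec_zero]
  intro i
  rw [h4]; rfl

/-- The basis of `𝔥*` formed by the simple roots. -/
def simpleRootBasis : Module.Basis (Fin 10) ℝ CartanDual :=
  basisOfLinearIndependentOfCardEqFinrank linearIndependent_simpleRoot
    (by simp [Subspace.dual_finrank_eq])

theorem simpleRootBasis_apply (i : Fin 10) : simpleRootBasis i = simpleRoot i := by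
  simp [simpleRootBasis]

/-- The bilinear form `(· | ·)` on `𝔥*`, given by `(αᵢ | αⱼ) = aᵢⱼ`. -/
def form : LinearMap.BilinForm ℝ CartanDual :=
  Matrix.toBilin simpleRootBasis (cartanMatrix.map (Int.cast : ℤ → ℝ))

theorem form_simpleRoot (i j : Fin 10) :
    form (simpleRoot i) (simpleRoot j) = cartanMatrix i j := by
  rw [← simpleRootBasis_apply, ← simpleRootBasis_apply, form, ← LinearMap.BilinForm.toMatrix_apply,
    LinearMap.BilinForm.toMatrix_toBilin, Matrix.map_apply]

/-- The simple reflection `rᵢ(λ) = λ - λ(αᵢ^∨) αᵢ` of `𝔥*`. -/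
def simpleReflection (i : Fin 10) : CartanDual ≃ₗ[ℝ] CartanDual :=
  Module.reflection (x := simpleRoot i) (f := Module.Dual.eval ℝ Cartan (simpleCoroot i)) (by
    rw [Module.Dual.eval_apply, simpleRoot_simpleCoroot]
    fin_cases i <;> simp [cartanMatrix])

theorem simpleReflection_apply (i : Fin 10) (l : CartanDual) :
    simpleReflection i l = l - l (simpleCoroot i) • simpleRoot i := by
  simp [simpleReflection, Module.reflection_apply]

/-- The Weyl group, generated by the simple reflections. -/
def weylGroup : Subgroup (CartanDual ≃ₗ[ℝ] CartanDual) :=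
  Subgroup.closure (Set.range simpleReflection)

/-- The Kac–Moody algebra `E₁₀` over `ℂ`, given by the Chevalley generators and the Chevalley–Serre
relations of its Cartan matrix. -/
abbrev KacMoodyAlgebra : Type := Matrix.ToLieAlgebra ℂ cartanMatrix

/-- The canonical map `𝔥 → E₁₀`; it sends `αᵢ^∨` to the Chevalley generator `Hᵢ`. -/
def ofCartan (h : Cartan) : KacMoodyAlgebra :=
  (LieSubmodule.Quotient.mk (∑ i, (h i : ℂ) • FreeLieAlgebra.of ℂ (CartanMatrix.Generators.H i)) :
    FreeLieAlgebra ℂ (CartanMatrix.Generators (Fin 10)) ⧸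
      CartanMatrix.Relations.toIdeal ℂ cartanMatrix)

/-- The subspace of all `x` with `[h, x] = α(h) x` for every `h ∈ 𝔥`. -/
def rootSpace (α : CartanDual) : Submodule ℂ KacMoodyAlgebra where
  carrier := {x | ∀ h : Cartan, ⁅ofCartan h, x⁆ = (α h : ℂ) • x}
  zero_mem' := by intro h; simp
  add_mem' := by intro x y hx hy h; rw [lie_add, hx h, hy h, smul_add]
  smul_mem' := by intro c x hx h; rw [lie_smul, hx h, smul_comm]

/-- The roots of `E₁₀`: the non-zero `α ∈ 𝔥*` with a non-zero root space. -/
def roots : Set CartanDual := {α | rootSpace α ≠ ⊥ ∧ α ≠ 0}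

/-- The combinations of simple roots with coefficients in the non-negative integers. -/
def positiveLattice : Set CartanDual := {α | ∃ k : Fin 10 → ℕ, α = ∑ i, k i • simpleRoot i}

/-- The positive roots. -/
def positiveRoots : Set CartanDual := roots ∩ positiveLattice

/-- The imaginary roots: the roots with `(α | α) ≤ 0`. -/
def imaginaryRoots : Set CartanDual := {α | α ∈ roots ∧ form α α ≤ 0}

/-- The positive imaginary roots. -/
def positiveImaginaryRoots : Set CartanDual := imaginaryRoots ∩ positiveRoots

end E10

end

namespace E10

open Matrix

/-! Descent on height in the root lattice. Deleting any node of the diagram leaves one of finite or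
affine type, so the form is non-negative on vectors with a zero coefficient
(`quadratic_nonneg_of_apply_eq_zero`). Hence a simple reflection cannot make a coefficient of a
non-negative vector of negative norm negative (`sub_single_nonneg`). Reflecting wherever `(A k)ᵢ >
0` lowers the height, so the process stops at some `k` with `p = -A k ≥ 0`. There `k = (-A⁻¹) p`
with `-A⁻¹ ≥ 0` entrywise, and `∑ kᵢ pᵢ = 2` leaves a single solution (`eq_of_antidominant`). -/

theorem quadratic_eq (k : Fin 10 → ℤ) :
    k ⬝ᵥ cartanMatrix *ᵥ k =
      2 * (k 0 ^ 2 + k 1 ^ 2 + k 2 ^ 2 + k 3 ^ 2 + k 4 ^ 2 + k 5 ^ 2 + k 6 ^ 2 + k 7 ^ 2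
        + k 8 ^ 2 + k 9 ^ 2 - k 0 * k 1 - k 1 * k 2 - k 2 * k 3 - k 3 * k 4 - k 4 * k 5
        - k 5 * k 6 - k 6 * k 7 - k 7 * k 8 - k 6 * k 9) := by
  simp [dotProduct, mulVec, cartanMatrix, Fin.sum_univ_succ]
  ring

/-- If `w` is the `i`-th row of the negated inverse Cartan matrix, then the form is a sum of
squares `(wₘ kₗ - wₗ kₘ)² / (wₗ wₘ)` over the edges of the Dynkin diagram, up to a multiple
of `kᵢ²`. -/
theorem quadratic_nonneg_of_apply_eq_zero (k : Fin 10 → ℤ) (i : Fin 10) (hi : k i = 0) :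
    0 ≤ k ⬝ᵥ cartanMatrix *ᵥ k := by
  have h (l m : Fin 10) := sq_nonneg (-cartanMatrixInv i m * k l - -cartanMatrixInv i l * k m)
  have h01 := h 0 1
  have h12 := h 1 2
  have h23 := h 2 3
  have h34 := h 3 4
  have h45 := h 4 5
  have h56 := h 5 6
  have h67 := h 6 7
  have h78 := h 7 8
  have h69 := h 6 9
  clear h
  rw [quadratic_eq]
  -- The coefficients to be found are `1 / (wₗ wₘ)`. Only `w₀` in row `0` vanishes, and there the
  -- edge `0 — 1` contributes nothing because `k₀ = 0`.
  fin_cases i <;> simp [cartanMatrixInv] at * <;> simp only [hi] at * <;> linarith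

theorem isSymm_cartanMatrix : cartanMatrix.IsSymm := by
  decide +kernel

theorem cartanMatrix_apply_self (i : Fin 10) : cartanMatrix i i = 2 := by
  revert i; decide +kernel

theorem quadratic_sub_single (k : Fin 10 → ℤ) (i : Fin 10) (c : ℤ) :
    (k - Pi.single i c) ⬝ᵥ cartanMatrix *ᵥ (k - Pi.single i c) =
      k ⬝ᵥ cartanMatrix *ᵥ k - 2 * c * (cartanMatrix *ᵥ k) i + 2 * c ^ 2 := by
  have h : k ⬝ᵥ cartanMatrix *ᵥ Pi.single i c = c * (cartanMatrix *ᵥ k) i := by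
    rw [dotProduct_mulVec, ← mulVec_transpose, isSymm_cartanMatrix.eq, dotProduct_single, mul_comm]
  rw [mulVec_sub, dotProduct_sub, sub_dotProduct, sub_dotProduct, h, single_dotProduct,
    single_dotProduct, mulVec_single]
  simp [cartanMatrix_apply_self]
  ring

/-- A simple reflection keeps the coefficients of a vector of negative norm non-negative. -/
theorem sub_single_nonneg {k : Fin 10 → ℤ} (hk : 0 ≤ k) (hq : k ⬝ᵥ cartanMatrix *ᵥ k < 0)
    (i : Fin 10) : 0 ≤ k - Pi.single i ((cartanMatrix *ᵥ k) i) := by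
  -- Removing the `i`-th coefficient yields `kᵢ (kᵢ - (A k)ᵢ) ≥ -q / 2 > 0`, where `q` is the norm
  -- of `k`; as `kᵢ ≥ 0`, the reflected coefficient is positive.
  have h := quadratic_nonneg_of_apply_eq_zero (k - Pi.single i (k i)) i (by simp)
  rw [quadratic_sub_single] at h
  intro j
  have hi : 0 ≤ k i := hk i
  rcases eq_or_ne j i with rfl | hj
  · simp only [Pi.zero_apply, Pi.sub_apply, Pi.single_eq_same]
    nlinarith
  · simpa [Pi.single_eq_of_ne hj] using hk j

theorem neg_cartanMatrixInv_mulVec (k : Fin 10 → ℤ) :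
    (-cartanMatrixInv) *ᵥ (-(cartanMatrix *ᵥ k)) = k := by
  rw [mulVec_neg, neg_mulVec, neg_neg, mulVec_mulVec, mul_eq_one_comm.mp cartanMatrix_mul_inv,
    one_mulVec]

theorem neg_cartanMatrixInv_nonneg (i j : Fin 10) : 0 ≤ (-cartanMatrixInv) i j := by
  change 0 ≤ -cartanMatrixInv i j
  revert i j; decide +kernel

/-- The two excluded diagonal entries are `0` and `2`. Any bound above `2` would serve to exclude
`pᵢ ≥ 1`, since each `kᵢ pᵢ` is at most `2`. -/
theorem four_le_neg_cartanMatrixInv_diag (i : Fin 10) (h0 : i ≠ 0) (h1 : i ≠ 1) :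
    4 ≤ (-cartanMatrixInv) i i := by
  change 4 ≤ -cartanMatrixInv i i
  revert i; decide +kernel

/-- The only vector of norm `-2` in the antidominant chamber is `-Λ₀`. -/
theorem eq_of_antidominant {k : Fin 10 → ℤ} (hk : ∀ i, (cartanMatrix *ᵥ k) i ≤ 0)
    (hq : k ⬝ᵥ cartanMatrix *ᵥ k = -2) : k = ![1, 2, 4, 6, 8, 10, 12, 8, 4, 6] := by
  obtain ⟨p, hp⟩ : ∃ p, p = -(cartanMatrix *ᵥ k) := ⟨_, rfl⟩
  have hkp : (-cartanMatrixInv) *ᵥ p = k := hp ▸ neg_cartanMatrixInv_mulVec k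
  have hp0 (i) : 0 ≤ p i := by simpa [hp] using hk i
  have hle (i) : (-cartanMatrixInv) i i * p i ≤ k i := by
    rw [← hkp]
    exact Finset.single_le_sum (f := fun j => (-cartanMatrixInv) i j * p j)
      (fun j _ => mul_nonneg (neg_cartanMatrixInv_nonneg i j) (hp0 j)) (Finset.mem_univ i)
  have hk0 (i) : 0 ≤ k i :=
    (mul_nonneg (neg_cartanMatrixInv_nonneg i i) (hp0 i)).trans (hle i)
  have hsum : ∑ i, k i * p i = 2 := by
    have : k ⬝ᵥ p = 2 := by rw [hp, dotProduct_neg, hq, neg_neg]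
    exact this
  have hzero (i : Fin 10) (h0 : i ≠ 0) (h1 : i ≠ 1) : p i = 0 := by
    by_contra hne
    have hpi : 1 ≤ p i := by have := hp0 i; omega
    have h2 : k i * p i ≤ 2 := hsum ▸ Finset.single_le_sum (f := fun j => k j * p j)
      (fun j _ => mul_nonneg (hk0 j) (hp0 j)) (Finset.mem_univ i)
    have h4 := four_le_neg_cartanMatrixInv_diag i h0 h1
    have hki : 4 ≤ k i := (by nlinarith : 4 ≤ (-cartanMatrixInv) i i * p i).trans (hle i)
    nlinarith
  have hp' : p = ![p 0, p 1, 0, 0, 0, 0, 0, 0, 0, 0] := by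
    funext i
    fin_cases i
    · rfl
    · rfl
    all_goals exact hzero _ (by decide) (by decide)
  -- `p 0` multiplies the null root of the affine subdiagram `E₉`, and `p 1` multiplies the target
  -- vector.
  have hk' : k = ![p 1, p 0 + 2 * p 1, 2 * p 0 + 4 * p 1, 3 * p 0 + 6 * p 1, 4 * p 0 + 8 * p 1,
      5 * p 0 + 10 * p 1, 6 * p 0 + 12 * p 1, 4 * p 0 + 8 * p 1, 2 * p 0 + 4 * p 1,
      3 * p 0 + 6 * p 1] := by
    rw [← hkp]
    conv_lhs => rw [hp']
    funext i
    fin_cases i <;> simp [cartanMatrixInv, mulVec, dotProduct, Fin.sum_univ_succ] <;> ring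
  -- Half of `k₀ p₀ + k₁ p₁ = 2 p₀ p₁ + 2 p₁²`.
  have h2 : p 1 * (p 0 + p 1) = 1 := by
    have h : k ⬝ᵥ p = 2 := hsum
    rw [hp', hk'] at h
    simp [dotProduct, Fin.sum_univ_succ] at h
    linarith
  have h1 : p 1 = 1 := by nlinarith [hp0 0, hp0 1]
  have h0 : p 0 = 0 := by rw [h1] at h2; omega
  rw [hk', h0, h1]
  norm_num

/-- The element of the root lattice with the given coefficients. -/
def ofCoeff (k : Fin 10 → ℤ) : CartanDual := ∑ i, (k i : ℝ) • simpleRoot i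

theorem ofCoeff_simpleCoroot (k : Fin 10 → ℤ) (i : Fin 10) :
    ofCoeff k (simpleCoroot i) = ((cartanMatrix *ᵥ k) i : ℤ) := by
  simp [ofCoeff, simpleRoot_simpleCoroot, mulVec, dotProduct, mul_comm]

theorem form_ofCoeff (k : Fin 10 → ℤ) :
    form (ofCoeff k) (ofCoeff k) = (k ⬝ᵥ cartanMatrix *ᵥ k : ℤ) := by
  have h (i j : Fin 10) : cartanMatrix i j = cartanMatrix j i := isSymm_cartanMatrix.apply j i
  simp only [ofCoeff, map_sum, map_smul, LinearMap.sum_apply, LinearMap.smul_apply, smul_eq_mul,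
    form_simpleRoot, mulVec, dotProduct, Finset.mul_sum, Int.cast_sum, Int.cast_mul]
  refine Finset.sum_congr rfl fun i _ => Finset.sum_congr rfl fun j _ => ?_
  rw [h i j]
  ring

theorem simpleReflection_ofCoeff (k : Fin 10 → ℤ) (i : Fin 10) :
    simpleReflection i (ofCoeff k) = ofCoeff (k - Pi.single i ((cartanMatrix *ᵥ k) i)) := by
  rw [simpleReflection_apply, ofCoeff_simpleCoroot]
  refine LinearMap.ext fun h => ?_
  simp [ofCoeff, sub_mul, Finset.sum_sub_distrib, Pi.single_apply]

/-- Descent on the height: every non-negative vector of norm `-2` is conjugate to `-Λ₀`. -/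
theorem exists_mem_weylGroup_ofCoeff (n : ℕ) (k : Fin 10 → ℤ) (hn : ∑ i, k i = n) (hk : 0 ≤ k)
    (hq : k ⬝ᵥ cartanMatrix *ᵥ k = -2) :
    ∃ w ∈ weylGroup, w (ofCoeff k) = ofCoeff ![1, 2, 4, 6, 8, 10, 12, 8, 4, 6] := by
  induction n using Nat.strong_induction_on generalizing k with
  | _ n ih =>
    by_cases hdom : ∀ i, (cartanMatrix *ᵥ k) i ≤ 0
    · exact ⟨1, one_mem _, by rw [eq_of_antidominant hdom hq]; rfl⟩
    · push Not at hdom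
      obtain ⟨i, hi⟩ := hdom
      have hk' := sub_single_nonneg hk (by omega) i
      have hq' := quadratic_sub_single k i ((cartanMatrix *ᵥ k) i)
      have hn' : ∑ j, (k - Pi.single i ((cartanMatrix *ᵥ k) i) : Fin 10 → ℤ) j
          = n - (cartanMatrix *ᵥ k) i := by
        simp [Finset.sum_sub_distrib, hn]
      have hpos := Finset.sum_nonneg fun j (_ : j ∈ Finset.univ) => hk' j
      rw [hn'] at hpos
      -- The new height is non-negative by `hpos`, so `toNat` loses nothing.
      obtain ⟨w, hw, h⟩ := ih (n - (cartanMatrix *ᵥ k) i).toNat (by omega) _ (by rw [hn']; omega) hk'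
        (by rw [hq', hq]; ring)
      exact ⟨w * simpleReflection i, mul_mem hw (Subgroup.subset_closure ⟨i, rfl⟩), by
        rw [LinearEquiv.mul_apply, simpleReflection_ofCoeff, h]⟩

end E10

theorem mainTheorem3 (α : E10.CartanDual) (hα : α ∈ E10.positiveImaginaryRoots)
    (hsq : E10.form α α = -2) :
    ∃ w ∈ E10.weylGroup,
      w α = E10.simpleRoot 0 + (2 : ℝ) • E10.simpleRoot 1 + (4 : ℝ) • E10.simpleRoot 2
        + (6 : ℝ) • E10.simpleRoot 3 + (8 : ℝ) • E10.simpleRoot 4 + (10 : ℝ) • E10.simpleRoot 5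
        + (12 : ℝ) • E10.simpleRoot 6 + (8 : ℝ) • E10.simpleRoot 7 + (4 : ℝ) • E10.simpleRoot 8
        + (6 : ℝ) • E10.simpleRoot 9 := by
  obtain ⟨k, hk⟩ := hα.2.2
  obtain rfl : α = E10.ofCoeff fun i => k i := by
    simp [hk, E10.ofCoeff, Nat.cast_smul_eq_nsmul]
  rw [E10.form_ofCoeff] at hsq
  obtain ⟨w, hw, h⟩ := E10.exists_mem_weylGroup_ofCoeff (∑ i, k i) _ (by push_cast; rfl)
    (fun i => Int.natCast_nonneg _) (by exact_mod_cast hsq)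
  refine ⟨w, hw, h.trans ?_⟩
  simp [E10.ofCoeff, Fin.sum_univ_succ]
  abel
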